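/- Let $N\ge 1$. Let $U_N\subset M_N(\mathbb C)$ be the unitary group and $O_N\subset U_N$ the subgroup of real orthogonal matrices, let $\mathbb T=\{w\in\mathbb C:|w|=1\}$ be identified with the scalar matrices $wI_N\in U_N$, and put $$\mathbb TO_N=\{wA\mid w\in\mathbb T,\ A\in O_N\}\subset U_N.$$ Let $PU_N=U_N/\mathbb T$ with the quotient topology, and let $PO_N=O_N/(O_N\cap\mathbb T)\subset PU_N$ be the image of $O_N$. Then the following inclusions of compact (Hausdorff) groups are maximal among compact groups: 1. $\mathbb TO_N\subset U_N$; 2. $PO_N\subset PU_N$. That is, if $G$ is a compact subgroup with $\mathbb TO_N\subset G\subset U_N$, then $G=\mathbb TO_N$ or $G=U_N$; and if $G$ is a compact subgroup with $PO_N\subset G\subset PU_N$, then $G=PO_N$ or $G=PU_N$. Moreover, both inclusions are proper when $N\ge 2$. -/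

import Mathlib

/-- The embedding `O_N → U_N` which regards a real orthogonal matrix as a complex unitary one. -/
noncomputable def orthogonalToUnitary (N : ℕ) :
    Matrix.orthogonalGroup (Fin N) ℝ →* Matrix.unitaryGroup (Fin N) ℂ where
  toFun A := ⟨(A : Matrix (Fin N) (Fin N) ℝ).map Complex.ofReal, by
    have h := (Matrix.mem_orthogonalGroup_iff (Fin N) ℝ).1 A.2
    rw [Matrix.mem_unitaryGroup_iff, Matrix.star_eq_conjTranspose]
    have h2 : ((A : Matrix (Fin N) (Fin N) ℝ).map Complex.ofReal).conjTranspose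
        = ((A : Matrix (Fin N) (Fin N) ℝ).transpose).map Complex.ofRealHom := by
      ext i j; simp
    have h3 : (A : Matrix (Fin N) (Fin N) ℝ).map Complex.ofReal
        = (A : Matrix (Fin N) (Fin N) ℝ).map Complex.ofRealHom := rfl
    rw [h2, h3, ← Matrix.map_mul, h]
    simp⟩
  map_one' := by
    apply Subtype.ext
    exact Matrix.map_one _ Complex.ofReal_zero Complex.ofReal_one
  map_mul' A B := by
    apply Subtype.ext
    exact Matrix.map_mul (f := Complex.ofRealHom)

/-- The embedding `𝕋 → U_N` which sends `w` to the scalar matrix `w I_N`. -/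
noncomputable def circleToUnitary (N : ℕ) : Circle →* Matrix.unitaryGroup (Fin N) ℂ where
  toFun w := ⟨(w : ℂ) • (1 : Matrix (Fin N) (Fin N) ℂ), by
    rw [Matrix.mem_unitaryGroup_iff, star_smul, star_one, smul_mul_smul_comm, mul_one]
    have h : (w : ℂ) * star (w : ℂ) = 1 := by
      rw [Complex.star_def, Complex.mul_conj, Circle.normSq_coe, Complex.ofReal_one]
    rw [h, one_smul]⟩
  map_one' := by
    apply Subtype.ext
    simp
  map_mul' w z := by
    apply Subtype.ext
    simp [smul_smul, mul_comm]

lemma circleToUnitary_comm (N : ℕ) (w : Circle) (U : Matrix.unitaryGroup (Fin N) ℂ) :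
    circleToUnitary N w * U = U * circleToUnitary N w := by
  apply Subtype.ext
  simp [circleToUnitary]

/-- The orthogonal group `O_N`, as a subgroup of `U_N`. -/
noncomputable def orthogonalSubgroup (N : ℕ) : Subgroup (Matrix.unitaryGroup (Fin N) ℂ) :=
  (orthogonalToUnitary N).range

/-- The group `𝕋` of scalar unitary matrices, as a subgroup of `U_N`. -/
noncomputable def scalarSubgroup (N : ℕ) : Subgroup (Matrix.unitaryGroup (Fin N) ℂ) :=
  (circleToUnitary N).range

instance scalarSubgroup_normal (N : ℕ) : (scalarSubgroup N).Normal where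
  conj_mem := by
    rintro _ ⟨w, rfl⟩ U
    refine ⟨w, ?_⟩
    rw [← circleToUnitary_comm, mul_assoc, mul_inv_cancel, mul_one]

/-- The group `𝕋O_N = {wA | w ∈ 𝕋, A ∈ O_N}`, as a subgroup of `U_N`. -/
noncomputable def circleOrthogonalSubgroup (N : ℕ) : Subgroup (Matrix.unitaryGroup (Fin N) ℂ) where
  carrier := {U | ∃ (w : Circle) (A : Matrix.orthogonalGroup (Fin N) ℝ),
    U = circleToUnitary N w * orthogonalToUnitary N A}
  one_mem' := ⟨1, 1, by simp⟩
  mul_mem' := by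
    rintro _ _ ⟨w, A, rfl⟩ ⟨z, B, rfl⟩
    refine ⟨w * z, A * B, ?_⟩
    rw [map_mul, map_mul, mul_assoc, ← mul_assoc _ (circleToUnitary N z),
      ← circleToUnitary_comm, mul_assoc, mul_assoc]
  inv_mem' := by
    rintro _ ⟨w, A, rfl⟩
    exact ⟨w⁻¹, A⁻¹, by rw [mul_inv_rev, map_inv, map_inv, ← map_inv (circleToUnitary N),
      circleToUnitary_comm]⟩

/-- The projective unitary group `PU_N = U_N / 𝕋`, with the quotient topology. -/
abbrev ProjectiveUnitaryGroup (N : ℕ) : Type :=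
  Matrix.unitaryGroup (Fin N) ℂ ⧸ scalarSubgroup N

/-- The projective version `PG ⊆ PU_N` of a subgroup `G ⊆ U_N`: the image of `G` in `U_N / 𝕋`, which
is `G / (G ∩ 𝕋)`. -/
noncomputable def projectiveVersion {N : ℕ} (G : Subgroup (Matrix.unitaryGroup (Fin N) ℂ)) :
    Subgroup (ProjectiveUnitaryGroup N) :=
  G.map (QuotientGroup.mk' (scalarSubgroup N))

/-- The inclusion of groups `A ⊆ B`, where `B` is a topological group, is maximal among compact
groups: `A` and `B` are compact Hausdorff, and there is no compact group strictly between them. -/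
structure IsMaximalCompactInclusion {B : Type*} [Group B] [TopologicalSpace B]
    [IsTopologicalGroup B] (A : Subgroup B) : Prop where
  t2Space : T2Space B
  compactSpace : CompactSpace B
  isCompact : IsCompact (A : Set B)
  eq_or_eq_top : ∀ G : Subgroup B, IsCompact (G : Set B) → A ≤ G → G = A ∨ G = ⊤

/-! Maximality comes from the decomposition `U_N = O_N · 𝕋^N · O_N`
(`exists_orthogonal_mul_diagonal_mul_orthogonal`): a group `G ⊇ 𝕋O_N` is determined by the diagonal
unitaries it contains. Write `U ∈ G` outside `𝕋O_N` as `A D B`; then `D ∈ G`. If all ratios of the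
entries of `D` were real, `D` would be a scalar times a sign matrix, and `U` would lie in `𝕋O_N`. So
some ratio `u` of two entries is nonreal.

Conjugating by `D` a rotation in the corresponding coordinate plane gives an element of `SU₂` in
`G`. Its double cosets modulo real rotations contain `diag(z, z̄)` for every `z` on the circle with
`|Im z| < |Im u|` (`exists_orthogonal_mul_twisted_rotation_mul_orthogonal`), and powers of these
fill the circle. Such circles spread to all pairs of coordinates and, with the scalars, generate the
torus (`torusDiagonal_mem`). Hence `G = U_N`.

The projective case follows by pulling subgroups back to `U_N`, because the preimage of `PO_N` is
`𝕋O_N`. -/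

/-! ### Joint diagonalization and the decomposition `U = A D B`. -/

/-- Two commuting self-adjoint operators on a finite-dimensional inner product space have a joint
orthonormal eigenbasis. -/
theorem LinearMap.IsSymmetric.exists_orthonormalBasis_joint_eigenvectors
    {E : Type*} [NormedAddCommGroup E] [InnerProductSpace ℝ E] [FiniteDimensional ℝ E]
    {S T : E →ₗ[ℝ] E} (hS : S.IsSymmetric) (hT : T.IsSymmetric) (hST : Commute S T)
    {n : ℕ} (hn : Module.finrank ℝ E = n) :
    ∃ b : OrthonormalBasis (Fin n) ℝ E, ∀ i, (∃ x : ℝ, S (b i) = x • b i) ∧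
      ∃ y : ℝ, T (b i) = y • b i := by
  classical
  -- `T` preserves each eigenspace of `S`, so it can be diagonalized inside each of them and the
  -- bases collected.
  have hinv (μ : ℝ) : Set.MapsTo T (Module.End.eigenspace S μ) (Module.End.eigenspace S μ) :=
    Module.End.mapsTo_genEigenspace_of_comm hST μ 1
  let v (μ : Module.End.Eigenvalues S) :=
    (hT.restrict_invariant (hinv (μ : ℝ))).eigenvectorBasis rfl
  let b := hS.direct_sum_isInternal.collectedOrthonormalBasis hS.orthogonalFamily_eigenspaces' v
  have hcard : Fintype.card ((μ : Module.End.Eigenvalues S) ×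
      Fin (Module.finrank ℝ (Module.End.eigenspace S (μ : ℝ)))) = n := by
    rw [← hn, Module.finrank_eq_card_basis b.toBasis]
  refine ⟨b.reindex (Fintype.equivFinOfCardEq hcard), fun i ↦ ?_⟩
  rw [OrthonormalBasis.reindex_apply]
  generalize (Fintype.equivFinOfCardEq hcard).symm i = a
  refine ⟨⟨(a.1 : ℝ), ?_⟩, ?_⟩
  · exact Module.End.mem_eigenspace_iff.1
      (hS.direct_sum_isInternal.collectedOrthonormalBasis_mem hS.orthogonalFamily_eigenspaces' v a)
  · have h := (hT.restrict_invariant (hinv (a.1 : ℝ))).apply_eigenvectorBasis rfl a.2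
    have hb : b a = (v a.1 a.2 : E) := by
      simp [b, DirectSum.IsInternal.collectedOrthonormalBasis]
    rw [hb]
    exact ⟨(hT.restrict_invariant (hinv (a.1 : ℝ))).eigenvalues rfl a.2, congrArg Subtype.val h⟩

namespace Matrix

/-- Two commuting real symmetric matrices are simultaneously orthogonally diagonalizable. -/
theorem exists_orthogonal_joint_diagonalization {N : ℕ} {X Y : Matrix (Fin N) (Fin N) ℝ}
    (hX : X.transpose = X) (hY : Y.transpose = Y) (hXY : X * Y = Y * X) :
    ∃ A ∈ orthogonalGroup (Fin N) ℝ, ∃ x y : Fin N → ℝ,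
      X = A * diagonal x * A.transpose ∧ Y = A * diagonal y * A.transpose := by
  have hX' : X.toEuclideanLin.IsSymmetric := isSymmetric_toEuclideanLin_iff.2 (by
    rw [IsHermitian, conjTranspose_eq_transpose_of_trivial, hX])
  have hY' : Y.toEuclideanLin.IsSymmetric := isSymmetric_toEuclideanLin_iff.2 (by
    rw [IsHermitian, conjTranspose_eq_transpose_of_trivial, hY])
  have hc : Commute X.toEuclideanLin Y.toEuclideanLin := by
    refine LinearMap.ext fun v ↦ ?_
    simp [toLpLin_apply, hXY]
  obtain ⟨b, hb⟩ := hX'.exists_orthonormalBasis_joint_eigenvectors hY' hc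
    (n := N) (by simp)
  choose x hx using fun i ↦ (hb i).1
  choose y hy using fun i ↦ (hb i).2
  let A : Matrix (Fin N) (Fin N) ℝ := of fun i j ↦ b j i
  have hA : A.transpose * A = 1 := by
    ext i j
    have h := orthonormal_iff_ite.1 b.orthonormal i j
    rw [one_apply, ← h, mul_apply, PiLp.inner_apply]
    simp [A, mul_comm]
  have hA' : A * A.transpose = 1 := mul_eq_one_comm.1 hA
  have key (Z : Matrix (Fin N) (Fin N) ℝ) (z : Fin N → ℝ)
      (hz : ∀ i, Z.toEuclideanLin (b i) = z i • b i) : Z = A * diagonal z * A.transpose := by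
    have h1 : Z * A = A * diagonal z := by
      ext i j
      have h := congrArg (fun v : EuclideanSpace ℝ (Fin N) ↦ v i) (hz j)
      simp only [toLpLin_apply, PiLp.smul_apply, smul_eq_mul] at h
      rw [mul_diagonal, mul_comm]
      exact h
    rw [← h1, mul_assoc, hA', mul_one]
  exact ⟨A, (mem_orthogonalGroup_iff (Fin N) ℝ).2 hA', x, y, key X x hx, key Y y hy⟩

theorem map_ofReal_mul {m n p : Type*} [Fintype n] (A : Matrix m n ℝ) (B : Matrix n p ℝ) :
    (A * B).map Complex.ofReal = A.map Complex.ofReal * B.map Complex.ofReal :=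
  Matrix.map_mul (f := Complex.ofRealHom)

theorem map_ofReal_one {n : Type*} [DecidableEq n] :
    (1 : Matrix n n ℝ).map Complex.ofReal = 1 :=
  Matrix.map_one _ Complex.ofReal_zero Complex.ofReal_one

/-- The decomposition `U = A D B` of a unitary matrix, with `A`, `B` real orthogonal and `D`
diagonal unitary. -/
theorem exists_orthogonal_mul_diagonal_mul_orthogonal {N : ℕ} {U : Matrix (Fin N) (Fin N) ℂ}
    (hU : U ∈ unitaryGroup (Fin N) ℂ) :
    ∃ A ∈ orthogonalGroup (Fin N) ℝ, ∃ B ∈ orthogonalGroup (Fin N) ℝ, ∃ d : Fin N → Circle,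
      U = A.map Complex.ofReal * diagonal (fun i ↦ (d i : ℂ)) * B.map Complex.ofReal := by
  have hUU : U * U.conjTranspose = 1 := mem_unitaryGroup_iff.1 hU
  have hUU' : U.conjTranspose * U = 1 := mem_unitaryGroup_iff'.1 hU
  have hUt : U.transpose * U.map star = 1 := by
    have := congrArg transpose hUU'
    rw [transpose_mul, transpose_one] at this
    exact this
  -- If `U = A D B`, then `U Uᵀ = A D² Aᵀ`; so `A` and `D` are sought by diagonalizing this
  -- symmetric unitary matrix.
  set W := U * U.transpose with hW
  have hWt : W.transpose = W := by simp [hW, transpose_mul]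
  have hWW : W * W.map star = 1 := by
    have : W.map star = U.map star * U.conjTranspose := by
      ext i j; simp [hW, mul_apply]
    rw [this, hW, mul_assoc, ← mul_assoc U.transpose, hUt, one_mul, hUU]
  set X := W.map Complex.re with hXd
  set Y := W.map Complex.im with hYd
  have hWXY : W = X.map Complex.ofReal + Complex.I • Y.map Complex.ofReal := by
    ext i j
    simp [hXd, hYd, mul_comm Complex.I, Complex.re_add_im]
  have hX : X.transpose = X := by rw [hXd, ← transpose_map, hWt]
  have hY : Y.transpose = Y := by rw [hYd, ← transpose_map, hWt]
  -- This is the imaginary part of `(X + iY)(X - iY) = 1`.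
  have hXY : X * Y = Y * X := by
    ext i j
    have h := congrArg Complex.im (congrFun (congrFun hWW i) j)
    have h0 : ((1 : Matrix (Fin N) (Fin N) ℂ) i j).im = 0 := by
      rw [one_apply]; split_ifs <;> simp
    rw [h0, mul_apply, Complex.im_sum] at h
    simp only [map_apply, Complex.star_def, Complex.mul_im, Complex.conj_re, Complex.conj_im,
      Finset.sum_add_distrib, mul_neg, Finset.sum_neg_distrib] at h
    simp only [mul_apply, hXd, hYd, map_apply]
    linarith
  obtain ⟨A, hA, x, y, hxA, hyA⟩ := exists_orthogonal_joint_diagonalization hX hY hXY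
  have hA1 : A * A.transpose = 1 := (mem_orthogonalGroup_iff (Fin N) ℝ).1 hA
  have hA2 : A.transpose * A = 1 := mul_eq_one_comm.1 hA1
  set C := A.map Complex.ofReal with hC
  have hC1 : C * C.transpose = 1 := by
    rw [hC, ← transpose_map, ← map_ofReal_mul, hA1, map_ofReal_one]
  have hC2 : C.transpose * C = 1 := mul_eq_one_comm.1 hC1
  have hCs : C.map star = C := by ext i j; simp [hC]
  have hCh : C.conjTranspose = C.transpose := by
    rw [conjTranspose, transpose_map, hCs]
  set e : Fin N → ℂ := fun i ↦ x i + Complex.I * y i with he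
  have hWe : W = C * diagonal e * C.transpose := by
    have hd (z : Fin N → ℝ) :
        (diagonal z).map Complex.ofReal = diagonal (fun i ↦ (z i : ℂ)) := by
      rw [diagonal_map Complex.ofReal_zero]
    have hde : diagonal e = diagonal (fun i ↦ (x i : ℂ)) +
        Complex.I • diagonal (fun i ↦ (y i : ℂ)) := by
      rw [← diagonal_smul, diagonal_add]; rfl
    rw [hWXY, hxA, hyA, map_ofReal_mul, map_ofReal_mul, map_ofReal_mul, map_ofReal_mul, hd, hd,
      hde, transpose_map, ← hC]
    simp [mul_add, add_mul]
  have hunit (i : Fin N) : ‖e i‖ = 1 := by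
    have h1 : diagonal e = C.transpose * W * C := by
      rw [hWe, ← mul_assoc, ← mul_assoc, hC2, one_mul, mul_assoc, hC2, mul_one]
    have h2 : diagonal (fun i ↦ star (e i)) = C.transpose * W.map star * C := by
      have hWh : W.conjTranspose = W.map star := by rw [conjTranspose, hWt]
      have hCh' : C.transpose.conjTranspose = C := by rw [← hCh, conjTranspose_conjTranspose]
      have := congrArg conjTranspose h1
      rw [diagonal_conjTranspose, conjTranspose_mul, conjTranspose_mul, hWh, hCh, hCh',
        ← mul_assoc] at this
      exact this
    have h3 : diagonal e * diagonal (fun i ↦ star (e i)) = 1 := by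
      rw [h1, h2, mul_assoc, mul_assoc, ← mul_assoc C, ← mul_assoc C, hC1, one_mul,
        ← mul_assoc W, hWW, one_mul, hC2]
    have h4 := congrFun (congrFun h3 i) i
    rw [diagonal_mul_diagonal, diagonal_apply_eq, one_apply_eq, Complex.star_def,
      Complex.mul_conj, Complex.normSq_eq_norm_sq] at h4
    have h5 : ‖e i‖ ^ 2 = 1 := by exact_mod_cast h4
    exact (pow_eq_one_iff_of_nonneg (norm_nonneg _) two_ne_zero).1 h5
  have hroot (i : Fin N) : ∃ w : Circle, (w : ℂ) ^ 2 = e i := by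
    refine ⟨Circle.exp (Complex.arg (e i) / 2), ?_⟩
    rw [Circle.coe_exp, ← Complex.exp_nat_mul]
    have := Complex.norm_mul_exp_arg_mul_I (e i)
    rw [hunit, Complex.ofReal_one, one_mul] at this
    rw [← this]
    congr 1
    push_cast
    rw [this]
    ring
  choose d hd using hroot
  set D : Matrix (Fin N) (Fin N) ℂ := diagonal fun i ↦ (d i : ℂ) with hD
  set D' : Matrix (Fin N) (Fin N) ℂ := diagonal fun i ↦ (d i : ℂ)⁻¹ with hD'
  have hDD' : D * D' = 1 := by
    rw [hD, hD', diagonal_mul_diagonal]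
    simp
  have hD'D : D' * D = 1 := mul_eq_one_comm.1 hDD'
  have hDs : D'.conjTranspose = D := by
    rw [hD', diagonal_conjTranspose, hD]
    congr 1
    ext i
    simp [← Circle.coe_inv_eq_conj, ← Circle.coe_inv]
  have hDe : D * D = diagonal e := by
    rw [hD, diagonal_mul_diagonal]
    congr 1
    ext i
    rw [← hd i, sq]
  -- The only candidate for `B`. It satisfies both `V V* = 1` and `V Vᵀ = 1`, hence `V* = Vᵀ`, so
  -- its entries are real.
  set V := D' * C.transpose * U with hV
  have hVV : V * V.conjTranspose = 1 := by
    rw [hV, conjTranspose_mul, conjTranspose_mul, hDs, ← hCh, conjTranspose_conjTranspose, hCh]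
    calc D' * C.transpose * U * (U.conjTranspose * (C * D))
        = D' * (C.transpose * (U * U.conjTranspose) * C) * D := by noncomm_ring
      _ = 1 := by rw [hUU, mul_one, hC2, mul_one, hD'D]
  have hVt : V * V.transpose = 1 := by
    have hD't : D'.transpose = D' := diagonal_transpose _
    rw [hV, transpose_mul, transpose_mul, hD't, transpose_transpose]
    calc D' * C.transpose * U * (U.transpose * (C * D'))
        = D' * (C.transpose * (U * U.transpose) * C) * D' := by noncomm_ring
      _ = D' * ((C.transpose * C) * (D * D) * (C.transpose * C)) * D' := by
          rw [← hW, hWe, hDe]; noncomm_ring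
      _ = (D' * D) * (D * D') := by rw [hC2]; noncomm_ring
      _ = 1 := by rw [hDD', hD'D, mul_one]
  have hVreal : V.conjTranspose = V.transpose := by
    have h : V.transpose * V = 1 := mul_eq_one_comm.1 hVt
    calc V.conjTranspose = V.transpose * V * V.conjTranspose := by rw [h, one_mul]
      _ = V.transpose := by rw [mul_assoc, hVV, mul_one]
  have hB : V = (V.map Complex.re).map Complex.ofReal := by
    ext i j
    have h := congrFun (congrFun hVreal j) i
    rw [conjTranspose_apply, transpose_apply, Complex.star_def, Complex.conj_eq_iff_re] at h
    simpa using h.symm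
  refine ⟨A, hA, V.map Complex.re, ?_, d, ?_⟩
  · rw [mem_orthogonalGroup_iff]
    change V.map Complex.re * (V.map Complex.re).transpose = 1
    apply Matrix.map_injective Complex.ofReal_injective
    change Matrix.map _ Complex.ofReal = Matrix.map _ Complex.ofReal
    rw [map_ofReal_mul, transpose_map, ← hB, hVt, map_ofReal_one]
  · rw [← hB, hV, ← hC, ← hD]
    calc U = C * C.transpose * U := by rw [hC1, one_mul]
      _ = C * (D * D') * C.transpose * U := by rw [hDD', mul_one]
      _ = _ := by noncomm_ring

end Matrix

/-! ### Planar blocks and double cosets of rotations in `SU₂`. -/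

namespace Matrix

/-- The matrix acting as the `2 × 2` matrix `M` on the coordinates `e (inl _)` and as the identity
on the others. -/
def twoBlock {R n κ : Type*} [Zero R] [One R] [DecidableEq κ] (e : Fin 2 ⊕ κ ≃ n)
    (M : Matrix (Fin 2) (Fin 2) R) : Matrix n n R :=
  (fromBlocks M 0 0 1).submatrix e.symm e.symm

theorem twoBlock_mul {R n κ : Type*} [CommRing R] [Fintype n] [Fintype κ] [DecidableEq κ]
    (e : Fin 2 ⊕ κ ≃ n) (M M' : Matrix (Fin 2) (Fin 2) R) :
    twoBlock e (M * M') = twoBlock e M * twoBlock e M' := by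
  simp [twoBlock, submatrix_mul_equiv, fromBlocks_multiply]

theorem twoBlock_transpose {R n κ : Type*} [CommRing R] [DecidableEq κ] (e : Fin 2 ⊕ κ ≃ n)
    (M : Matrix (Fin 2) (Fin 2) R) :
    twoBlock e M.transpose = (twoBlock e M).transpose := by
  simp [twoBlock, fromBlocks_transpose]

theorem twoBlock_one {R n κ : Type*} [CommRing R] [DecidableEq n] [DecidableEq κ]
    (e : Fin 2 ⊕ κ ≃ n) : twoBlock e (1 : Matrix (Fin 2) (Fin 2) R) = 1 := by
  simp [twoBlock]

theorem twoBlock_map_ofReal {n κ : Type*} [DecidableEq κ] (e : Fin 2 ⊕ κ ≃ n)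
    (M : Matrix (Fin 2) (Fin 2) ℝ) :
    (twoBlock e M).map Complex.ofReal = twoBlock e (M.map Complex.ofReal) := by
  ext a b
  obtain ⟨a, rfl⟩ := e.surjective a
  obtain ⟨b, rfl⟩ := e.surjective b
  rcases a with a | a <;> rcases b with b | b <;> simp [twoBlock, one_apply, apply_ite]

theorem twoBlock_mem_orthogonalGroup {n κ : Type*} [Fintype n] [DecidableEq n] [Fintype κ]
    [DecidableEq κ] (e : Fin 2 ⊕ κ ≃ n) {M : Matrix (Fin 2) (Fin 2) ℝ}
    (hM : M ∈ orthogonalGroup (Fin 2) ℝ) : twoBlock e M ∈ orthogonalGroup n ℝ := by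
  have h : M * M.transpose = 1 := (mem_orthogonalGroup_iff _ _).1 hM
  rw [mem_orthogonalGroup_iff]
  change twoBlock e M * (twoBlock e M).transpose = 1
  rw [← twoBlock_transpose, ← twoBlock_mul, h, twoBlock_one]

/-- Conjugating a block matrix by a diagonal unitary matrix only changes the block. -/
theorem diagonal_mul_twoBlock_mul_diagonal {n κ : Type*} [Fintype n] [DecidableEq n]
    [DecidableEq κ] (e : Fin 2 ⊕ κ ≃ n) (d : n → Circle) (M : Matrix (Fin 2) (Fin 2) ℂ) :
    diagonal (fun i ↦ (d i : ℂ)) * twoBlock e M *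
      (diagonal (fun i ↦ (d i : ℂ))).conjTranspose =
    twoBlock e (of fun a b ↦ M a b * (d (e (.inl a)) / d (e (.inl b)) : Circle)) := by
  ext a b
  rw [diagonal_conjTranspose, mul_diagonal, diagonal_mul]
  obtain ⟨a, rfl⟩ := e.surjective a
  obtain ⟨b, rfl⟩ := e.surjective b
  have hd (i : n) : star (d i : ℂ) = (d i : ℂ)⁻¹ := by
    rw [Complex.star_def, ← Circle.coe_inv_eq_conj, Circle.coe_inv]
  rcases a with a | a <;> rcases b with b | b
  · simp [twoBlock, div_eq_mul_inv, hd]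
    ring
  · simp [twoBlock]
  · simp [twoBlock]
  · rcases eq_or_ne a b with rfl | h
    · simp [twoBlock, hd]
    · simp [twoBlock, h]

/-- A complex square root of `a + bi`, that is, the half-angle. -/
theorem exists_sq_sub_sq_eq_and_two_mul_eq {a b : ℝ} (h : a ^ 2 + b ^ 2 = 1) :
    ∃ x y : ℝ, x ^ 2 + y ^ 2 = 1 ∧ x ^ 2 - y ^ 2 = a ∧ 2 * x * y = b := by
  obtain ⟨w, hw⟩ := IsAlgClosed.exists_pow_nat_eq (⟨a, b⟩ : ℂ) two_pos
  have h1 := congrArg Complex.re hw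
  have h2 := congrArg Complex.im hw
  simp only [sq, Complex.mul_re, Complex.mul_im] at h1 h2
  refine ⟨w.re, w.im, ?_, by linarith, by linarith⟩
  have h3 : (w.re ^ 2 + w.im ^ 2) ^ 2 = 1 := by
    rw [← h, ← h1, ← h2]; ring
  exact (pow_eq_one_iff_of_nonneg (by positivity) two_ne_zero).1 h3

theorem rotation_mem_orthogonalGroup {c s : ℝ} (h : c ^ 2 + s ^ 2 = 1) :
    !![c, -s; s, c] ∈ orthogonalGroup (Fin 2) ℝ := by
  rw [mem_orthogonalGroup_iff]
  ext i j
  fin_cases i <;> fin_cases j <;> simp [mul_apply, Fin.sum_univ_two] <;> linarith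

/-- If `u` is a nonreal number of modulus one, then the diagonal matrices in `SU₂` with small angle
are obtained from a rotation conjugated by `diag(u, 1)` via multiplication by orthogonal
matrices. -/
theorem exists_orthogonal_mul_twisted_rotation_mul_orthogonal {u : ℂ} (hu : ‖u‖ = 1)
    {z : ℂ} (hz : ‖z‖ = 1) (hzu : |z.im| < |u.im|) :
    ∃ A ∈ orthogonalGroup (Fin 2) ℝ, ∃ B ∈ orthogonalGroup (Fin 2) ℝ,
      ∃ c s : ℝ, c ^ 2 + s ^ 2 = 1 ∧
      A.map Complex.ofReal * !![(c : ℂ), -s * u; s * star u, c] * B.map Complex.ofReal =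
        !![z, 0; 0, star z] := by
  obtain ⟨k, σ⟩ := u
  obtain ⟨p, q⟩ := z
  have hu2 : k ^ 2 + σ ^ 2 = 1 := by
    have := Complex.sq_norm (⟨k, σ⟩ : ℂ)
    rw [hu, Complex.normSq_mk] at this
    linarith
  have hz2 : p ^ 2 + q ^ 2 = 1 := by
    have := Complex.sq_norm (⟨p, q⟩ : ℂ)
    rw [hz, Complex.normSq_mk] at this
    linarith
  simp only at hzu
  have hσ : σ ≠ 0 := by
    rintro rfl
    rw [abs_zero] at hzu
    exact absurd hzu (not_lt.2 (abs_nonneg q))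
  have hqσ : q ^ 2 < σ ^ 2 := sq_lt_sq.2 hzu
  have hp : p ≠ 0 := by
    rintro rfl
    nlinarith [sq_nonneg k]
  -- For a matrix `M`, multiplication by rotations on both sides preserves `tr(M Mᵀ)`. It equals `2
  -- - 4s²σ²` for the twisted rotation and `2 - 4q²` for `diag(z, z̄)`, which forces `s² = q²/σ²`.
  set s : ℝ := -q / σ with hs
  have hsσ : s * σ = -q := by rw [hs]; field_simp
  have hs1 : s ^ 2 ≤ 1 := by
    rw [hs, div_pow, neg_sq]
    exact div_le_one_of_le₀ hqσ.le (sq_nonneg _)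
  set c : ℝ := Real.sqrt (1 - s ^ 2) with hc
  have hcs : c ^ 2 + s ^ 2 = 1 := by
    rw [hc, Real.sq_sqrt (by linarith)]; ring
  -- The real part of the twisted rotation is `p` times a rotation; `a` and `b` are the entries of
  -- the inverse rotation.
  set a : ℝ := -(s * k) / p with ha
  set b : ℝ := c / p with hb
  have hpa : s * k = -(p * a) := by rw [ha]; field_simp
  have hpb : c = p * b := by rw [hb]; field_simp
  have hab : a ^ 2 + b ^ 2 = 1 := by
    have h : p ^ 2 * (a ^ 2 + b ^ 2) = p ^ 2 * 1 := by
      have h1 : p ^ 2 * (a ^ 2 + b ^ 2) = (s * k) ^ 2 + c ^ 2 := by rw [hpa, hpb]; ring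
      have h2 : (s * σ) ^ 2 = q ^ 2 := by rw [hsσ]; ring
      rw [h1]
      linear_combination hcs + s ^ 2 * hu2 - h2 - hz2
    exact mul_left_cancel₀ (pow_ne_zero 2 hp) h
  -- What remains is `p + iq` times the reflection `!![a, b; b, -a]`, with `p` scalar; the
  -- half-angle rotation diagonalizes this reflection to `diag(1, -1)`.
  obtain ⟨x, y, hxy, hxa, hyb⟩ := exists_sq_sub_sq_eq_and_two_mul_eq hab
  refine ⟨!![x, -(-y); -y, x], rotation_mem_orthogonalGroup (by linarith [neg_sq y]),
    !![b, -a; a, b] * !![x, -y; y, x], mul_mem (rotation_mem_orthogonalGroup (by linarith))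
      (rotation_mem_orthogonalGroup hxy), c, s, hcs, ?_⟩
  have hmid : !![(c : ℂ), -s * ⟨k, σ⟩; s * star ⟨k, σ⟩, c] *
      (!![b, -a; a, b]).map Complex.ofReal =
      !![p + Complex.I * q * a, Complex.I * q * b; Complex.I * q * b, p - Complex.I * q * a] := by
    have hu' : (⟨k, σ⟩ : ℂ) = k + Complex.I * σ := by
      rw [Complex.mk_eq_add_mul_I, mul_comm]
    have hu'' : star (⟨k, σ⟩ : ℂ) = k - Complex.I * σ := by
      apply Complex.ext <;> simp
    have hpa' : (s : ℂ) * k = -(p * a) := by exact_mod_cast congrArg Complex.ofReal hpa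
    have hpb' : (c : ℂ) = p * b := by exact_mod_cast congrArg Complex.ofReal hpb
    have hsσ' : (s : ℂ) * σ = -q := by exact_mod_cast congrArg Complex.ofReal hsσ
    have hab' : (a : ℂ) ^ 2 + b ^ 2 = 1 := by exact_mod_cast congrArg Complex.ofReal hab
    rw [hu'', hu']
    ext i j
    fin_cases i <;> fin_cases j <;> simp [mul_apply, Fin.sum_univ_two]
    · linear_combination b * hpb' - a * hpa' - a * Complex.I * hsσ' + p * hab'
    · linear_combination - a * hpb' - b * hpa' - b * Complex.I * hsσ'
    · linear_combination a * hpb' + b * hpa' - b * Complex.I * hsσ'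
    · linear_combination b * hpb' - a * hpa' + a * Complex.I * hsσ' + p * hab'
  rw [map_ofReal_mul, mul_assoc, ← mul_assoc _ (map _ _), hmid]
  have hz' : (⟨p, q⟩ : ℂ) = p + Complex.I * q := by
    rw [Complex.mk_eq_add_mul_I, mul_comm]
  have hz'' : star (⟨p, q⟩ : ℂ) = p - Complex.I * q := by
    apply Complex.ext <;> simp
  have hxy' : (x : ℂ) ^ 2 + y ^ 2 = 1 := by exact_mod_cast congrArg Complex.ofReal hxy
  have hxa' : (x : ℂ) ^ 2 - y ^ 2 = a := by exact_mod_cast congrArg Complex.ofReal hxa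
  have hyb' : 2 * (x : ℂ) * y = b := by exact_mod_cast congrArg Complex.ofReal hyb
  rw [hz'', hz', ← hxa', ← hyb']
  ext i j
  fin_cases i <;> fin_cases j <;> simp [mul_apply, vecMul, dotProduct, Fin.sum_univ_two]
  · linear_combination (p + Complex.I * q * (x ^ 2 + y ^ 2 + 1)) * hxy'
  · ring
  · ring
  · linear_combination (p - Complex.I * q * (x ^ 2 + y ^ 2 + 1)) * hxy'

end Matrix

/-! ### Powers and roots in the torus. -/

/-- The element of the torus `𝕋^n` with `w` and `w⁻¹` at the positions `i`, `j` and `1` elsewhere. -/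
noncomputable def Circle.mulPair {n : Type*} [DecidableEq n] (i j : n) (w : Circle) : n → Circle :=
  Pi.mulSingle i w * Pi.mulSingle j w⁻¹

theorem Circle.mulPair_pow {n : Type*} [DecidableEq n] (i j : n) (w : Circle) (k : ℕ) :
    mulPair i j w ^ k = mulPair i j (w ^ k) := by
  rw [mulPair, mulPair, mul_pow, ← Pi.mulSingle_pow, ← Pi.mulSingle_pow, inv_pow]

theorem Circle.mulPair_apply_left {n : Type*} [DecidableEq n] {i j : n} (h : i ≠ j) (w : Circle) :
    mulPair i j w i = w := by
  simp [mulPair, h]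

theorem Circle.mulPair_apply_right {n : Type*} [DecidableEq n] {i j : n} (h : i ≠ j) (w : Circle) :
    mulPair i j w j = w⁻¹ := by
  simp [mulPair, h.symm]

theorem Circle.mulPair_apply_of_ne {n : Type*} [DecidableEq n] {i j k : n} (hi : k ≠ i)
    (hj : k ≠ j) (w : Circle) : mulPair i j w k = 1 := by
  simp [mulPair, hi, hj]

theorem Circle.exists_pow_eq {n : ℕ} (hn : n ≠ 0) (w : Circle) : ∃ z : Circle, z ^ n = w := by
  refine ⟨Circle.exp (Complex.arg w / n), ?_⟩
  rw [← Circle.exp_nsmul, nsmul_eq_mul, mul_div_cancel₀ _ (Nat.cast_ne_zero.2 hn),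
    Circle.exp_arg]

/-- Dividing the argument by a large `n` gives a root near `1`. This passes from a small arc to the
whole circle by taking powers. -/
theorem Circle.exists_pow_eq_and_abs_im_lt (w : Circle) {ε : ℝ} (hε : 0 < ε) :
    ∃ (n : ℕ) (z : Circle), z ^ n = w ∧ |(z : ℂ).im| < ε := by
  obtain ⟨n, hn⟩ := exists_nat_gt (|Complex.arg w| / ε)
  have hn0 : (0 : ℝ) < n := lt_of_le_of_lt (by positivity) hn
  refine ⟨n, Circle.exp (Complex.arg w / n), ?_, ?_⟩
  · rw [← Circle.exp_nsmul, nsmul_eq_mul, mul_div_cancel₀ _ hn0.ne', Circle.exp_arg]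
  · rw [Circle.coe_exp, Complex.exp_ofReal_mul_I_im]
    refine lt_of_le_of_lt Real.abs_sin_le_abs ?_
    rw [abs_div, abs_of_pos hn0, div_lt_iff₀ hn0]
    rw [div_lt_iff₀ hε] at hn
    linarith

/-! ### Generating the torus from one nonreal ratio. -/

open Circle

namespace Matrix

/-- The diagonal unitary matrices, as a homomorphism from the torus. -/
noncomputable def torusDiagonal (N : ℕ) : (Fin N → Circle) →* Matrix (Fin N) (Fin N) ℂ where
  toFun d := diagonal fun i ↦ (d i : ℂ)
  map_one' := by simp
  map_mul' d d' := by simp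

theorem torusDiagonal_apply {N : ℕ} (d : Fin N → Circle) :
    torusDiagonal N d = diagonal fun i ↦ (d i : ℂ) := rfl

/-- In a ∗-closed monoid of matrices containing the real orthogonal ones, a diagonal unitary matrix
with two entries of nonreal ratio yields the corresponding full diagonal circle of `SU₂`. -/
theorem torusDiagonal_mulPair_mem {N : ℕ} {S : Submonoid (Matrix (Fin N) (Fin N) ℂ)}
    (hO : ∀ A ∈ orthogonalGroup (Fin N) ℝ, A.map Complex.ofReal ∈ S)
    (hS : ∀ M ∈ S, M.conjTranspose ∈ S) {d : Fin N → Circle} (hd : torusDiagonal N d ∈ S)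
    {i j : Fin N} (hij : ((d i / d j : Circle) : ℂ).im ≠ 0) (w : Circle) :
    torusDiagonal N (mulPair i j w) ∈ S := by
  classical
  have hne : i ≠ j := by
    rintro rfl
    simp at hij
  obtain ⟨n, z, rfl, hz⟩ := w.exists_pow_eq_and_abs_im_lt (abs_pos.2 hij)
  rw [← mulPair_pow, map_pow]
  refine pow_mem ?_ n
  have hf : Function.Injective ![i, j] := by
    intro a b
    fin_cases a <;> fin_cases b <;> simp [hne, hne.symm]
  let e : Fin 2 ⊕ ((Set.range ![i, j])ᶜ : Set (Fin N)) ≃ Fin N :=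
    (Equiv.sumCongr (Equiv.ofInjective _ hf) (Equiv.refl _)).trans
      (Equiv.Set.sumCompl (Set.range ![i, j]))
  have he0 : e (.inl 0) = i := by simp [e]
  have he1 : e (.inl 1) = j := by simp [e]
  obtain ⟨A, hA, B, hB, c, s, hcs, h⟩ :=
    exists_orthogonal_mul_twisted_rotation_mul_orthogonal (Circle.norm_coe _) (Circle.norm_coe z) hz
  -- The product is `A (d R d*) B`, with `R` the rotation by `(c, s)` in the plane of coordinates
  -- `i`, `j`.
  have hmem := S.mul_mem (S.mul_mem (hO _ (twoBlock_mem_orthogonalGroup e hA))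
    (S.mul_mem (S.mul_mem hd (hO _ (twoBlock_mem_orthogonalGroup e
      (rotation_mem_orthogonalGroup hcs)))) (hS _ hd))) (hO _ (twoBlock_mem_orthogonalGroup e hB))
  rw [torusDiagonal_apply, twoBlock_map_ofReal, twoBlock_map_ofReal, twoBlock_map_ofReal,
    diagonal_mul_twoBlock_mul_diagonal] at hmem
  have hmid : (of fun a b ↦ (!![c, -s; s, c].map Complex.ofReal) a b *
      ((d (e (.inl a)) / d (e (.inl b)) : Circle) : ℂ)) =
      !![(c : ℂ), -s * (d i / d j : Circle); s * star ((d i / d j : Circle) : ℂ), c] := by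
    have hstar : star ((d i / d j : Circle) : ℂ) = (d j / d i : Circle) := by
      rw [Complex.star_def, ← Circle.coe_inv_eq_conj, inv_div]
    rw [hstar]
    ext a b
    fin_cases a <;> fin_cases b <;> simp [he0, he1]
  rw [hmid, ← twoBlock_mul, ← twoBlock_mul, h] at hmem
  convert hmem using 1
  have hzs : star (z : ℂ) = (z⁻¹ : Circle) := by
    rw [Complex.star_def, ← Circle.coe_inv_eq_conj]
  rw [hzs, torusDiagonal_apply]
  ext a b
  obtain ⟨a, rfl⟩ := e.surjective a
  obtain ⟨b, rfl⟩ := e.surjective b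
  simp only [diagonal_apply, e.injective.eq_iff]
  rcases a with a | a <;> rcases b with b | b
  · have h0 : mulPair i j z (e (.inl 0)) = z := by rw [he0, mulPair_apply_left hne]
    have h1 : mulPair i j z (e (.inl 1)) = z⁻¹ := by rw [he1, mulPair_apply_right hne]
    fin_cases a <;> fin_cases b <;> simp [twoBlock, h0, h1]
  · simp [twoBlock]
  · simp [twoBlock]
  · have hi : e (.inr a) ≠ i := fun h ↦ by simpa using e.injective (h.trans he0.symm)
    have hj : e (.inr a) ≠ j := fun h ↦ by simpa using e.injective (h.trans he1.symm)
    simp [twoBlock, mulPair_apply_of_ne hi hj, one_apply, apply_ite]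

/-- A ∗-closed monoid of matrices containing the real orthogonal and the scalar unitary ones, and a
diagonal unitary matrix with two entries of nonreal ratio, contains all diagonal unitary
matrices. -/
theorem torusDiagonal_mem {N : ℕ} {S : Submonoid (Matrix (Fin N) (Fin N) ℂ)}
    (hO : ∀ A ∈ orthogonalGroup (Fin N) ℝ, A.map Complex.ofReal ∈ S)
    (hS : ∀ M ∈ S, M.conjTranspose ∈ S) (hT : ∀ w : Circle, torusDiagonal N (fun _ ↦ w) ∈ S)
    {d : Fin N → Circle} (hd : torusDiagonal N d ∈ S)
    {i j : Fin N} (hij : ((d i / d j : Circle) : ℂ).im ≠ 0) (D : Fin N → Circle) :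
    torusDiagonal N D ∈ S := by
  have hne : i ≠ j := by
    rintro rfl
    simp at hij
  have hpair (k : Fin N) (hk : k ≠ i) (w : Circle) : torusDiagonal N (mulPair i k w) ∈ S := by
    have hI : ((Circle.exp (Real.pi / 2) : Circle) : ℂ).im = 1 := by
      rw [Circle.coe_exp, Complex.exp_ofReal_mul_I_im, Real.sin_pi_div_two]
    rcases eq_or_ne k j with rfl | hkj
    · exact torusDiagonal_mulPair_mem hO hS hd hij w
    -- The `(i, j)` circle contains the element with entry `√-1` at `i` and `1` at `k`, whose
    -- nonreal ratio produces the `(i, k)` circle.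
    · refine torusDiagonal_mulPair_mem hO hS
        (torusDiagonal_mulPair_mem hO hS hd hij (Circle.exp (Real.pi / 2))) ?_ w
      rw [mulPair_apply_left hne, mulPair_apply_of_ne hk hkj, div_one, hI]
      exact one_ne_zero
  have hN : N ≠ 0 := by rintro rfl; exact i.elim0
  -- The scalar `s` absorbs the determinant of `D`. The pair factors then fix the entries away from
  -- `i`, and entry `i` is correct because `s ^ N = ∏ D k`.
  obtain ⟨s, hs⟩ := Circle.exists_pow_eq hN (∏ k, D k)
  have hD : D = (fun _ ↦ s) * ∏ k ∈ Finset.univ.erase i, mulPair i k (s / D k) := by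
    ext1 m
    rw [Pi.mul_apply, Finset.prod_apply]
    rcases eq_or_ne m i with rfl | hm
    · have h1 : ∏ k ∈ Finset.univ.erase m, mulPair m k (s / D k) m =
          ∏ k ∈ Finset.univ.erase m, s / D k :=
        Finset.prod_congr rfl fun k hk ↦ mulPair_apply_left (Finset.ne_of_mem_erase hk).symm _
      have h2 : s * ∏ k ∈ Finset.univ.erase m, s / D k = D m * ∏ k, s / D k := by
        rw [← Finset.mul_prod_erase Finset.univ (fun k ↦ s / D k) (Finset.mem_univ m), ← mul_assoc,
          mul_div_cancel]
      rw [h1, h2, Finset.prod_div_distrib, Finset.prod_const, Finset.card_univ, Fintype.card_fin,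
        hs, div_self', mul_one]
    · rw [Finset.prod_eq_single_of_mem m (Finset.mem_erase.2 ⟨hm, Finset.mem_univ m⟩)
        (fun k hk hkm ↦ mulPair_apply_of_ne hm hkm.symm _), mulPair_apply_right hm.symm,
        inv_div, mul_div_cancel]
  have hprod : ∏ k ∈ Finset.univ.erase i, mulPair i k (s / D k) ∈ S.comap (torusDiagonal N) :=
    prod_mem fun k hk ↦ hpair k (Finset.ne_of_mem_erase hk) _
  rw [hD, map_mul]
  exact S.mul_mem (hT s) hprod

end Matrix

/-! ### Maximality and properness in `U_N`. -/

open Matrix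

theorem scalarSubgroup_le_circleOrthogonalSubgroup (N : ℕ) :
    scalarSubgroup N ≤ circleOrthogonalSubgroup N := by
  rintro _ ⟨w, rfl⟩
  exact ⟨w, 1, by rw [map_one, mul_one]⟩

theorem orthogonalSubgroup_le_circleOrthogonalSubgroup (N : ℕ) :
    orthogonalSubgroup N ≤ circleOrthogonalSubgroup N := by
  rintro _ ⟨A, rfl⟩
  exact ⟨1, A, by rw [map_one, one_mul]⟩

/-- The subgroup `𝕋O_N` is maximal in `U_N`, as an abstract subgroup. -/
theorem eq_circleOrthogonalSubgroup_or_eq_top {N : ℕ}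
    {G : Subgroup (Matrix.unitaryGroup (Fin N) ℂ)} (hG : circleOrthogonalSubgroup N ≤ G) :
    G = circleOrthogonalSubgroup N ∨ G = ⊤ := by
  by_cases hle : G ≤ circleOrthogonalSubgroup N
  · exact .inl (le_antisymm hle hG)
  right
  obtain ⟨U, hUG, hU⟩ := SetLike.not_le_iff_exists.1 hle
  let S : Submonoid (Matrix (Fin N) (Fin N) ℂ) :=
    G.toSubmonoid.map (Submonoid.subtype (Matrix.unitaryGroup (Fin N) ℂ))
  have hmemS (V : Matrix.unitaryGroup (Fin N) ℂ) :
      (V : Matrix (Fin N) (Fin N) ℂ) ∈ S ↔ V ∈ G := by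
    constructor
    · rintro ⟨V', hV', h⟩
      rwa [← Subtype.ext h]
    · exact fun h ↦ ⟨V, h, rfl⟩
  have hO : ∀ A ∈ orthogonalGroup (Fin N) ℝ, A.map Complex.ofReal ∈ S := fun A hA ↦
    (hmemS (orthogonalToUnitary N ⟨A, hA⟩)).2
      (hG (orthogonalSubgroup_le_circleOrthogonalSubgroup N ⟨_, rfl⟩))
  have hS : ∀ M ∈ S, M.conjTranspose ∈ S := by
    rintro _ ⟨V, hV, rfl⟩
    exact (hmemS V⁻¹).2 (G.inv_mem hV)
  have hT : ∀ w : Circle, torusDiagonal N (fun _ ↦ w) ∈ S := by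
    intro w
    have := (hmemS (circleToUnitary N w)).2
      (hG (scalarSubgroup_le_circleOrthogonalSubgroup N ⟨w, rfl⟩))
    rwa [torusDiagonal_apply, ← smul_one_eq_diagonal]
  obtain ⟨A, hA, B, hB, d, hd⟩ := exists_orthogonal_mul_diagonal_mul_orthogonal U.2
  have hAt : A.transpose ∈ orthogonalGroup (Fin N) ℝ := Unitary.star_mem hA
  have hBt : B.transpose ∈ orthogonalGroup (Fin N) ℝ := Unitary.star_mem hB
  have hA1 : A.transpose * A = 1 := (mem_orthogonalGroup_iff' _ _).1 hA
  have hB1 : B * B.transpose = 1 := (mem_orthogonalGroup_iff _ _).1 hB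
  have hdS : torusDiagonal N d ∈ S := by
    have h := S.mul_mem (S.mul_mem (hO _ hAt) ((hmemS U).2 hUG)) (hO _ hBt)
    rwa [hd, ← mul_assoc, ← mul_assoc, ← map_ofReal_mul, hA1, map_ofReal_one, one_mul, mul_assoc,
      ← map_ofReal_mul, hB1, map_ofReal_one, mul_one] at h
  -- Real ratios of unit complex numbers are `±1`, which puts `U` in `𝕋O_N`; a nonreal one puts the
  -- whole torus in `S`.
  by_cases hreal : ∀ i j, ((d i / d j : Circle) : ℂ).im = 0
  · refine absurd ?_ hU
    rcases isEmpty_or_nonempty (Fin N) with hN | ⟨⟨i⟩⟩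
    · exact ⟨1, 1, Subtype.ext (Subsingleton.elim _ _)⟩
    let r : Fin N → ℝ := fun k ↦ ((d k / d i : Circle) : ℂ).re
    have hr (k : Fin N) : ((d k / d i : Circle) : ℂ) = r k := by
      apply Complex.ext
      · simp [r]
      · rw [hreal, Complex.ofReal_im]
    have hr2 (k : Fin N) : r k * r k = 1 := by
      have h := congrArg norm (hr k)
      rw [Circle.norm_coe, Complex.norm_real, Real.norm_eq_abs] at h
      rw [← abs_mul_abs_self, ← h, one_mul]
    have hrO : diagonal r ∈ orthogonalGroup (Fin N) ℝ := by
      rw [mem_orthogonalGroup_iff]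
      change diagonal r * (diagonal r).transpose = 1
      rw [diagonal_transpose, diagonal_mul_diagonal, ← diagonal_one]
      exact congrArg diagonal (funext hr2)
    refine ⟨d i, ⟨A * diagonal r * B, mul_mem (mul_mem hA hrO) hB⟩, Subtype.ext ?_⟩
    change (U : Matrix (Fin N) (Fin N) ℂ) = ((d i : ℂ) • (1 : Matrix (Fin N) (Fin N) ℂ)) *
      (A * diagonal r * B).map Complex.ofReal
    have hdr : diagonal (fun k ↦ (d k : ℂ)) = (d i : ℂ) • (diagonal r).map Complex.ofReal := by
      rw [diagonal_map Complex.ofReal_zero, ← diagonal_smul]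
      congr 1
      ext k
      change (d k : ℂ) = d i * (r k : ℂ)
      rw [← hr, ← Circle.coe_mul, mul_div_cancel]
    rw [hd, hdr, map_ofReal_mul, map_ofReal_mul, smul_mul_assoc, one_mul, mul_smul_comm,
      smul_mul_assoc]
  · push Not at hreal
    obtain ⟨i, j, hij⟩ := hreal
    rw [eq_top_iff]
    intro V _
    obtain ⟨A, hA, B, hB, D, hD⟩ := exists_orthogonal_mul_diagonal_mul_orthogonal V.2
    rw [← hmemS, hD]
    exact S.mul_mem (S.mul_mem (hO A hA) (torusDiagonal_mem hO hS hT hdS hij D)) (hO B hB)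

theorem circleOrthogonalSubgroup_ne_top {N : ℕ} (hN : 2 ≤ N) :
    circleOrthogonalSubgroup N ≠ ⊤ := by
  intro htop
  let i : Fin N := ⟨0, by omega⟩
  let j : Fin N := ⟨1, by omega⟩
  have hij : i ≠ j := by simp [i, j]
  -- In `𝕋O_N` two nonzero diagonal entries have a real ratio; here the ratio is `√-1`.
  let f : Fin N → ℂ := fun k ↦ if k = i then 1 else Complex.I
  have hf : diagonal f ∈ unitaryGroup (Fin N) ℂ := by
    rw [mem_unitaryGroup_iff, star_eq_conjTranspose, diagonal_conjTranspose,
      diagonal_mul_diagonal, ← diagonal_one]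
    congr 1
    ext k
    by_cases hk : k = i <;> simp [f, hk]
  obtain ⟨w, A, h⟩ : (⟨diagonal f, hf⟩ : unitaryGroup (Fin N) ℂ) ∈ circleOrthogonalSubgroup N := by
    rw [htop]; trivial
  have h' : diagonal f = ((w : ℂ) • (1 : Matrix (Fin N) (Fin N) ℂ)) *
      (A : Matrix (Fin N) (Fin N) ℝ).map Complex.ofReal := congrArg Subtype.val h
  rw [smul_mul_assoc, one_mul] at h'
  have hi := congrFun (congrFun h' i) i
  have hj := congrFun (congrFun h' j) j
  simp only [diagonal_apply_eq, Matrix.smul_apply, map_apply, smul_eq_mul, f, if_true,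
    if_neg hij.symm] at hi hj
  generalize (A : Matrix (Fin N) (Fin N) ℝ) i i = a at hi
  generalize (A : Matrix (Fin N) (Fin N) ℝ) j j = b at hj
  have hab : (b : ℂ) = Complex.I * a := by
    calc (b : ℂ) = b * (w * a) := by rw [← hi, mul_one]
      _ = (w * b) * a := by ring
      _ = Complex.I * a := by rw [← hj]
  have ha := congrArg Complex.im hab
  simp only [Complex.ofReal_im, Complex.mul_im, Complex.I_re, Complex.I_im, Complex.ofReal_re,
    zero_mul, one_mul, zero_add] at ha
  rw [← ha] at hi
  simp at hi

/-! ### Descent to `PU_N` and compactness. -/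

/-- Pulling back an image saturates it by the kernel `𝕋`. This carries maximality and properness
from `U_N` to `PU_N`. -/
theorem comap_projectiveVersion_orthogonalSubgroup (N : ℕ) :
    (projectiveVersion (orthogonalSubgroup N)).comap (QuotientGroup.mk' (scalarSubgroup N)) =
      circleOrthogonalSubgroup N := by
  apply le_antisymm
  · rintro U ⟨_, ⟨A, rfl⟩, h⟩
    obtain ⟨w, hw⟩ := QuotientGroup.eq.1 h
    refine ⟨w, A, ?_⟩
    rw [circleToUnitary_comm, hw, mul_inv_cancel_left]
  · rintro _ ⟨w, A, rfl⟩
    refine ⟨_, ⟨A, rfl⟩, QuotientGroup.eq.2 ⟨w, ?_⟩⟩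
    rw [circleToUnitary_comm, inv_mul_cancel_left]

/-- The defining equation is closed, and unitary entries have norm at most `1`. -/
instance compactSpace_unitaryGroup (N : ℕ) : CompactSpace (Matrix.unitaryGroup (Fin N) ℂ) := by
  suffices h : IsCompact (unitaryGroup (Fin N) ℂ : Set (Matrix (Fin N) (Fin N) ℂ)) from
    isCompact_iff_compactSpace.1 h
  have hK : IsCompact (Set.pi Set.univ fun _ : Fin N ↦ Set.pi Set.univ fun _ : Fin N ↦
      Metric.closedBall (0 : ℂ) 1) :=
    isCompact_univ_pi fun _ ↦ isCompact_univ_pi fun _ ↦ isCompact_closedBall _ _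
  refine hK.of_isClosed_subset ?_ fun U hU i _ j _ ↦ ?_
  · have : (unitaryGroup (Fin N) ℂ : Set (Matrix (Fin N) (Fin N) ℂ)) =
        {U | U * U.conjTranspose = 1} := by
      ext U
      exact mem_unitaryGroup_iff
    rw [this]
    exact isClosed_eq (by fun_prop) continuous_const
  · rw [mem_closedBall_zero_iff]
    exact entry_norm_bound_of_unitary hU i j

instance compactSpace_orthogonalGroup (N : ℕ) :
    CompactSpace (Matrix.orthogonalGroup (Fin N) ℝ) := by
  suffices h : IsCompact (orthogonalGroup (Fin N) ℝ : Set (Matrix (Fin N) (Fin N) ℝ)) from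
    isCompact_iff_compactSpace.1 h
  have hK : IsCompact (Set.pi Set.univ fun _ : Fin N ↦ Set.pi Set.univ fun _ : Fin N ↦
      Metric.closedBall (0 : ℝ) 1) :=
    isCompact_univ_pi fun _ ↦ isCompact_univ_pi fun _ ↦ isCompact_closedBall _ _
  refine hK.of_isClosed_subset ?_ fun U hU i _ j _ ↦ ?_
  · have : (orthogonalGroup (Fin N) ℝ : Set (Matrix (Fin N) (Fin N) ℝ)) =
        {U | U * U.transpose = 1} := by
      ext U
      exact mem_orthogonalGroup_iff _ _
    rw [this]
    exact isClosed_eq (by fun_prop) continuous_const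
  · rw [mem_closedBall_zero_iff]
    exact entry_norm_bound_of_unitary hU i j

theorem continuous_orthogonalToUnitary (N : ℕ) : Continuous (orthogonalToUnitary N) :=
  Continuous.subtype_mk (Continuous.matrix_map continuous_subtype_val Complex.continuous_ofReal) _

theorem continuous_circleToUnitary (N : ℕ) : Continuous (circleToUnitary N) :=
  Continuous.subtype_mk (Continuous.smul continuous_subtype_val continuous_const) _

theorem isCompact_orthogonalSubgroup (N : ℕ) :
    IsCompact (orthogonalSubgroup N : Set (Matrix.unitaryGroup (Fin N) ℂ)) :=
  isCompact_range (continuous_orthogonalToUnitary N)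

theorem isCompact_scalarSubgroup (N : ℕ) :
    IsCompact (scalarSubgroup N : Set (Matrix.unitaryGroup (Fin N) ℂ)) :=
  isCompact_range (continuous_circleToUnitary N)

theorem isCompact_circleOrthogonalSubgroup (N : ℕ) :
    IsCompact (circleOrthogonalSubgroup N : Set (Matrix.unitaryGroup (Fin N) ℂ)) := by
  have h : (circleOrthogonalSubgroup N : Set (Matrix.unitaryGroup (Fin N) ℂ)) =
      Set.range fun p : Circle × Matrix.orthogonalGroup (Fin N) ℝ ↦
        circleToUnitary N p.1 * orthogonalToUnitary N p.2 := by
    ext U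
    constructor
    · rintro ⟨w, A, rfl⟩
      exact ⟨(w, A), rfl⟩
    · rintro ⟨⟨w, A⟩, rfl⟩
      exact ⟨w, A, rfl⟩
  rw [h]
  exact isCompact_range (((continuous_circleToUnitary N).comp continuous_fst).mul
    ((continuous_orthogonalToUnitary N).comp continuous_snd))

theorem theorem12p20 (N : ℕ) (hN : 1 ≤ N) :
    IsMaximalCompactInclusion (circleOrthogonalSubgroup N) ∧
    IsMaximalCompactInclusion (projectiveVersion (orthogonalSubgroup N)) ∧
    (2 ≤ N → circleOrthogonalSubgroup N ≠ ⊤ ∧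
      projectiveVersion (orthogonalSubgroup N) ≠ ⊤) := by
  have hsurj := QuotientGroup.mk'_surjective (scalarSubgroup N)
  refine ⟨⟨inferInstance, inferInstance, isCompact_circleOrthogonalSubgroup N,
    fun G _ hG ↦ eq_circleOrthogonalSubgroup_or_eq_top hG⟩, ⟨?_, inferInstance, ?_, ?_⟩,
    fun h2 ↦ ⟨circleOrthogonalSubgroup_ne_top h2, fun htop ↦ circleOrthogonalSubgroup_ne_top h2 ?_⟩⟩
  -- A quotient by a closed normal subgroup is Hausdorff.
  · have : IsClosed (scalarSubgroup N : Set (Matrix.unitaryGroup (Fin N) ℂ)) :=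
      (isCompact_scalarSubgroup N).isClosed
    infer_instance
  · exact (isCompact_orthogonalSubgroup N).image continuous_quot_mk
  · intro G _ hG
    have hle := Subgroup.comap_mono (f := QuotientGroup.mk' (scalarSubgroup N)) hG
    rw [comap_projectiveVersion_orthogonalSubgroup] at hle
    refine (eq_circleOrthogonalSubgroup_or_eq_top hle).imp (fun h ↦ ?_) fun h ↦ ?_
    · rw [← comap_projectiveVersion_orthogonalSubgroup] at h
      exact Subgroup.comap_injective hsurj h
    · rw [← Subgroup.comap_top (QuotientGroup.mk' (scalarSubgroup N))] at h
      exact Subgroup.comap_injective hsurj h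
  · rw [← comap_projectiveVersion_orthogonalSubgroup, htop, Subgroup.comap_top]
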